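/- Let $n\ge 1$ and let $A=(a_{i,j})_{1\le i<j\le n}$ be non-negative real weights. For a finite-dimensional real representation $\rho$ of the symmetric group $S_n$ let $\lambda_1(A;\rho)$ be the smallest eigenvalue of $$\rho(\Delta_A)=\sum_{i<j}a_{i,j}\bigl(\rho(\mathrm{id})-\rho((i\,j))\bigr).$$ The Aldous order on irreducible representations of $S_n$ is defined by $\rho\preceq\sigma$ if and only if $\lambda_1(A;\rho)\ge\lambda_1(A;\sigma)$ for all non-negative weights $A$; we write $\sigma\succ\rho$ if $\rho\preceq\sigma$ and $\rho,\sigma$ are not isomorphic. For a partition $\tau=(\tau_1\ge\dots\ge\tau_m>0)$ of $n$, number the boxes of its Young diagram by $1,\dots,n$ consecutively along the rows, from the first row to the last, let $H$ and $V$ be the groups of permutations preserving each row, respectively each column, and let $[\tau]$ be the representation of $S_n$ by left multiplication on the left ideal $\mathbb R[S_n]\,c_\tau$, where $c_\tau=\bigl(\sum_{h\in H}h\bigr)\bigl(\sum_{v\in V}\operatorname{sign}(v)\,v\bigr)$; these are the irreducible representations of $S_n$. Let $\mathrm{str}_{n,n}$ be the star graph on $\{1,\dots,n\}$ in which the vertex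 $n$ is joined to each of $1,\dots,n-1$ (with weight $1$ on each edge). Then for every $n\ge 4$, $$\lambda_1(\mathrm{str}_{n,n};[2,2,1^{n-4}])=n-1,\qquad \lambda_1(\mathrm{str}_{n,n};[2,1^{n-2}])=n-2,$$ and consequently $[2,2,1^{n-4}]\nsucc[2,1^{n-2}]$ in the Aldous order, although $[2,2,1^{n-4}]\vartriangleright[2,1^{n-2}]$ in the dominance order (where $\tau\vartriangleright\sigma$ means $\tau\ne\sigma$ and $\tau_1+\dots+\tau_k\ge\sigma_1+\dots+\sigma_k$ for all $k$). -/

import Mathlib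

open scoped MonoidAlgebra

noncomputable section

namespace AldousOrder

/-! ### The smallest eigenvalue and the Aldous order -/

/-- `ρ(Δ_A) = ∑_{i<j} a_{ij} (ρ(id) - ρ((i j)))`. -/
def laplacian {n : ℕ} {V : Type*} [AddCommGroup V] [Module ℝ V]
    (A : Matrix (Fin n) (Fin n) ℝ) (ρ : Representation ℝ (Equiv.Perm (Fin n)) V) :
    Module.End ℝ V :=
  ∑ i : Fin n, ∑ j ∈ Finset.Ioi i, A i j • (ρ 1 - ρ (Equiv.swap i j))

/-- `λ₁(A;ρ)`, the smallest eigenvalue of `ρ(Δ_A)`. For a nonzero finite-dimensional `ρ`,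
`ρ(Δ_A)` is symmetric for an invariant inner product, so that the set of its real eigenvalues is
finite and non-empty, and the infimum is a minimum. -/
def lambdaOne {n : ℕ} {V : Type*} [AddCommGroup V] [Module ℝ V]
    (A : Matrix (Fin n) (Fin n) ℝ) (ρ : Representation ℝ (Equiv.Perm (Fin n)) V) : ℝ :=
  sInf {μ : ℝ | (laplacian A ρ).HasEigenvalue μ}

/-- `ρ ≼ σ`: for all non-negative weights, `λ₁(A;ρ) ≥ λ₁(A;σ)`. -/
def AldousLE {n : ℕ} {V W : Type*} [AddCommGroup V] [Module ℝ V] [AddCommGroup W] [Module ℝ W]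
    (ρ : Representation ℝ (Equiv.Perm (Fin n)) V)
    (σ : Representation ℝ (Equiv.Perm (Fin n)) W) : Prop :=
  ∀ A : Matrix (Fin n) (Fin n) ℝ, (∀ i j, i < j → 0 ≤ A i j) → lambdaOne A σ ≤ lambdaOne A ρ

/-- `ρ ≺ σ`: `ρ ≼ σ` and the two representations are different (not isomorphic). -/
def AldousLT {n : ℕ} {V W : Type*} [AddCommGroup V] [Module ℝ V] [AddCommGroup W] [Module ℝ W]
    (ρ : Representation ℝ (Equiv.Perm (Fin n)) V)
    (σ : Representation ℝ (Equiv.Perm (Fin n)) W) : Prop :=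
  AldousLE ρ σ ∧ ¬ Nonempty (ρ.Equiv σ)

/-! ### The irreducible representation of a partition -/

/-- The parts of a partition as a sequence `τ₁ ≥ τ₂ ≥ ⋯ ≥ τₘ > 0`. -/
def rows {n : ℕ} (τ : n.Partition) : Composition n where
  blocks := τ.parts.sort (· ≥ ·)
  blocks_pos := fun {_} hi => τ.parts_pos ((Multiset.mem_sort _).1 hi)
  blocks_sum := by
    rw [← Multiset.sum_coe, Multiset.sort_eq, τ.parts_sum]

/-- The permutations preserving each row of the diagram whose boxes are numbered consecutively
along the rows, from the first row to the last; `(rows τ).index i` is the row of `i`. -/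
def rowGroup {n : ℕ} (τ : n.Partition) : Set (Equiv.Perm (Fin n)) :=
  {h | ∀ i, (rows τ).index (h i) = (rows τ).index i}

/-- The permutations preserving each column of the same numbered diagram;
`(rows τ).invEmbedding i` is the position of `i` in its row. -/
def colGroup {n : ℕ} (τ : n.Partition) : Set (Equiv.Perm (Fin n)) :=
  {v | ∀ i, ((rows τ).invEmbedding (v i) : ℕ) = ((rows τ).invEmbedding i : ℕ)}

open Classical in
/-- `a_τ = ∑_{h ∈ H} h`. -/
def rowSum {n : ℕ} (τ : n.Partition) : ℝ[Equiv.Perm (Fin n)] :=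
  ∑ h : Equiv.Perm (Fin n) with h ∈ rowGroup τ, MonoidAlgebra.single h 1

open Classical in
/-- `b_τ = ∑_{v ∈ V} sign(v) v`. -/
def colSum {n : ℕ} (τ : n.Partition) : ℝ[Equiv.Perm (Fin n)] :=
  ∑ v : Equiv.Perm (Fin n) with v ∈ colGroup τ,
    MonoidAlgebra.single v ((Equiv.Perm.sign v : ℤ) : ℝ)

/-- The left ideal `R c_τ` of the group ring `R = ℝ[S_n]`, where `c_τ = a_τ b_τ`. -/
def youngIdeal {n : ℕ} (τ : n.Partition) :
    Submodule ℝ[Equiv.Perm (Fin n)] ℝ[Equiv.Perm (Fin n)] :=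
  Submodule.span _ {rowSum τ * colSum τ}

/-- The representation `[τ]`: `S_n` acting on `R c_τ` by left multiplication. -/
def irrep {n : ℕ} (τ : n.Partition) :
    Representation ℝ (Equiv.Perm (Fin n)) (youngIdeal τ) :=
  ((Algebra.lsmul ℝ ℝ (youngIdeal τ) :
      ℝ[Equiv.Perm (Fin n)] →ₐ[ℝ] Module.End ℝ (youngIdeal τ)) :
      ℝ[Equiv.Perm (Fin n)] →* Module.End ℝ (youngIdeal τ)).comp
    (MonoidAlgebra.of ℝ (Equiv.Perm (Fin n)))

/-! ### The dominance order -/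

/-- `σ ◁ τ` in the dominance order: `σ₁ + ⋯ + σₖ ≤ τ₁ + ⋯ + τₖ` for all `k`, and `σ ≠ τ`. -/
def DominanceLT {n : ℕ} (σ τ : n.Partition) : Prop :=
  (∀ k, ((rows σ).blocks.take k).sum ≤ ((rows τ).blocks.take k).sum) ∧ σ ≠ τ

/-! ### The two partitions and the star graph -/

/-- The partition `[2,2,1^{n-4}]`. -/
def partitionTwoTwo (n : ℕ) (hn : 4 ≤ n) : n.Partition where
  parts := 2 ::ₘ 2 ::ₘ Multiset.replicate (n - 4) 1
  parts_pos := by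
    intro i hi
    simp only [Multiset.mem_cons, Multiset.mem_replicate] at hi
    omega
  parts_sum := by
    simp only [Multiset.sum_cons, Multiset.sum_replicate, smul_eq_mul]
    omega

/-- The partition `[2,1^{n-2}]`. -/
def partitionTwo (n : ℕ) (hn : 2 ≤ n) : n.Partition where
  parts := 2 ::ₘ Multiset.replicate (n - 2) 1
  parts_pos := by
    intro i hi
    simp only [Multiset.mem_cons, Multiset.mem_replicate] at hi
    omega
  parts_sum := by
    simp only [Multiset.sum_cons, Multiset.sum_replicate, smul_eq_mul]
    omega

/-- The adjacency matrix of `K_{n,k}`: the first `k` of the `n` vertices are pairwise adjacent,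
the others are isolated. -/
def completeAdj (n k : ℕ) : Matrix (Fin n) (Fin n) ℝ :=
  Matrix.of fun i j => if i ≠ j ∧ (i : ℕ) < k ∧ (j : ℕ) < k then 1 else 0

/-- `str_{n,k} = K_{n,k} - K_{n,k-1}`: the star joining the `k`-th vertex to the `k - 1` vertices
before it. -/
def starAdj (n k : ℕ) : Matrix (Fin n) (Fin n) ℝ :=
  completeAdj n k - completeAdj n (k - 1)

end AldousOrder

end

namespace AldousOrder

open Equiv Finset

/-! ### Elements of the Young ideal as functions on the symmetric group -/

section YoungSymmetrizer

variable {n : ℕ} {τ : n.Partition}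

/-! View an element of `youngIdeal τ` as a function `x` on permutations. Let `τ` have two columns,
the second being the set of boxes `B`. Right multiplication by a column permutation multiplies `x`
by its sign (`coeff_mul_of_mem_youngIdeal`), and exchanging a box of `B` with the boxes of the first
column gives the Garnir relation `garnir_of_mem_youngIdeal`.

Let `l` be the centre of the star. Since `(i l) g = g (g⁻¹i g⁻¹l)`, the Laplacian at `g` only
involves exchanges of the box `g⁻¹ l` with the others. If this box lies in `B`, the two relations
make the Laplacian the scalar `α = n - 3 + #B`. Otherwise signs alone give the scalar `β = 2n - 2 -
#B`, minus values of `x` at permutations of the first kind. The operator is thus block triangular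
with possible eigenvalues `α < β` (as `2 * #B ≤ n`), and `α` does occur.

Taking `#B = 2` and `#B = 1` gives `n - 1` and `n - 2`, so the star itself violates the Aldous
inequality. -/

open Classical in
theorem coeff_rowSum_mul (y : ℝ[Perm (Fin n)]) (g : Perm (Fin n)) :
    (rowSum τ * y).coeff g = ∑ h : Perm (Fin n) with h ∈ rowGroup τ, y.coeff (h⁻¹ * g) := by
  simp [rowSum, Finset.sum_mul, Finsupp.finsetSum_apply, MonoidAlgebra.coeff_sum]

open Classical in
theorem coeff_colSum (g : Perm (Fin n)) :
    (colSum τ).coeff g = if g ∈ colGroup τ then ((Perm.sign g : ℤ) : ℝ) else 0 := by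
  simp [colSum, Finsupp.finsetSum_apply, MonoidAlgebra.coeff_sum, Finsupp.single_apply]

theorem coeff_colSum_mul {v : Perm (Fin n)} (hv : v ∈ colGroup τ) (g : Perm (Fin n)) :
    (colSum τ).coeff (g * v) = ((Perm.sign v : ℤ) : ℝ) * (colSum τ).coeff g := by
  have h : g * v ∈ colGroup τ ↔ g ∈ colGroup τ := by
    constructor
    · intro h i
      have := h (v⁻¹ i)
      have h2 := hv (v⁻¹ i)
      rw [← h2, Perm.mul_apply] at this
      simpa using this
    · intro h i
      rw [Perm.mul_apply, h, hv]
  by_cases hg : g ∈ colGroup τ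
  · simp [coeff_colSum, h, hg, mul_comm]
  · simp [coeff_colSum, h, hg]

/-- A box number is the start of its row plus its position in that row, so row and column together
determine the box. -/
theorem eq_one_of_mem_rowGroup_of_mem_colGroup {g : Perm (Fin n)} (h : g ∈ rowGroup τ)
    (h' : g ∈ colGroup τ) : g = 1 := by
  ext i
  have h1 := (rows τ).coe_invEmbedding (g i)
  have h2 := (rows τ).coe_invEmbedding i
  have h3 := (rows τ).sizeUpTo_index_le (g i)
  have h4 := (rows τ).sizeUpTo_index_le i
  rw [h' i] at h1
  rw [h i] at h1 h3
  simp only [Perm.one_apply]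
  omega

/-- Only `h = v = 1` contributes to `h v = 1`, because the row and column groups meet trivially.
This nonzero value later certifies that an eigenvector is nonzero. -/
theorem coeff_rowSum_mul_colSum_one : (rowSum τ * colSum τ).coeff 1 = 1 := by
  classical
  rw [coeff_rowSum_mul, Finset.sum_eq_single 1]
  · have : (1 : Perm (Fin n)) ∈ colGroup τ := fun i => rfl
    simp [coeff_colSum, this]
  · intro h hh h1
    rw [coeff_colSum, if_neg]
    intro hc
    apply h1
    rw [← inv_eq_one]
    refine eq_one_of_mem_rowGroup_of_mem_colGroup (τ := τ) (fun i => ?_) (by simpa using hc)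
    have := (Finset.mem_filter.1 hh).2 (h⁻¹ i)
    simpa using this.symm
  · intro h
    exact absurd (Finset.mem_filter.2 ⟨Finset.mem_univ _, fun i => rfl⟩) h

theorem coeff_mul_apply (y z : ℝ[Perm (Fin n)]) (g : Perm (Fin n)) :
    (y * z).coeff g = ∑ k, y.coeff k * z.coeff (k⁻¹ * g) := by
  have hy : y = ∑ k, MonoidAlgebra.single k (y.coeff k) := by
    ext k
    simp [MonoidAlgebra.coeff_sum]
  conv_lhs => rw [hy]
  simp [Finset.sum_mul, MonoidAlgebra.coeff_sum, Finsupp.finsetSum_apply]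

theorem coeff_mul_of_mem_youngIdeal {x : ℝ[Perm (Fin n)]} (hx : x ∈ youngIdeal τ)
    {v : Perm (Fin n)} (hv : v ∈ colGroup τ) (g : Perm (Fin n)) :
    x.coeff (g * v) = ((Perm.sign v : ℤ) : ℝ) * x.coeff g := by
  obtain ⟨y, rfl⟩ := Submodule.mem_span_singleton.1 hx
  rw [smul_eq_mul, ← mul_assoc, coeff_mul_apply, coeff_mul_apply, Finset.mul_sum]
  refine Finset.sum_congr rfl fun k _ => ?_
  rw [← mul_assoc k⁻¹, coeff_colSum_mul hv]
  ring

end YoungSymmetrizer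

section TwoColumns

/-! ### Diagrams with two columns -/

variable {n : ℕ} {τ : n.Partition} {B : Finset (Fin n)}

theorem coeff_colSum_of_two_columns (hcol : ∀ g, g ∈ colGroup τ ↔ B.map g.toEmbedding = B)
    (g : Perm (Fin n)) :
    (colSum τ).coeff g = ((Perm.sign g : ℤ) : ℝ) * if B.map g.toEmbedding = B then 1 else 0 := by
  classical
  simp [coeff_colSum, hcol]

theorem map_mul_swap (g : Perm (Fin n)) {j p : Fin n} (hp : p ∈ B) (hj : j ∉ B) :
    B.map (g * swap j p).toEmbedding = insert (g j) ((B.erase p).map g.toEmbedding) := by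
  ext i
  simp only [Finset.mem_map_equiv, Finset.mem_insert, Finset.mem_erase]
  have h1 : (g * swap j p).symm i = swap j p (g.symm i) := rfl
  have h2 : i = g j ↔ g.symm i = j := by rw [Equiv.symm_apply_eq]
  rw [h1, h2]
  rcases eq_or_ne (g.symm i) j with h | h
  · simp [h, hp]
  · rcases eq_or_ne (g.symm i) p with h' | h'
    · simp only [h', swap_apply_right]
      grind
    · rw [swap_apply_of_ne_of_ne h h']
      simp [h, h']

/-- The product of the column antisymmetrizer with `1 - ∑ (j p)`, summed over the first column. -/
theorem colSum_sub_sum_swap (hcol : ∀ g, g ∈ colGroup τ ↔ B.map g.toEmbedding = B)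
    {p : Fin n} (hp : p ∈ B) (g : Perm (Fin n)) :
    (colSum τ).coeff g - ∑ j ∈ Bᶜ, (colSum τ).coeff (g * swap j p) =
      ∑ r ∈ B, ((Perm.sign g : ℤ) : ℝ) *
        if (B.erase p).map g.toEmbedding = B.erase r then 1 else 0 := by
  have h1 : (colSum τ).coeff g = ((Perm.sign g : ℤ) : ℝ) *
      if insert (g p) ((B.erase p).map g.toEmbedding) = B then 1 else 0 := by
    rw [coeff_colSum_of_two_columns hcol]
    congr 3
    conv_lhs => rw [← Finset.insert_erase hp]
    rw [Finset.map_insert]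
    rfl
  have h2 : ∀ j ∈ Bᶜ, (colSum τ).coeff (g * swap j p) = -(((Perm.sign g : ℤ) : ℝ) *
      if insert (g j) ((B.erase p).map g.toEmbedding) = B then 1 else 0) := by
    intro j hj
    rw [Finset.mem_compl] at hj
    rw [coeff_colSum_of_two_columns hcol, map_mul_swap g hp hj, Perm.sign_mul, Perm.sign_swap
      (by rintro rfl; exact hj hp)]
    push_cast
    ring
  -- The leading term is the missing case `j = p`, so the sum now runs over all `j` outside `B.erase
  -- p`.
  rw [h1, Finset.sum_congr rfl h2, Finset.sum_neg_distrib, sub_neg_eq_add,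
    ← Finset.sum_insert (f := fun j => ((Perm.sign g : ℤ) : ℝ) *
      if insert (g j) ((B.erase p).map g.toEmbedding) = B then 1 else 0) (by simpa using hp),
    ← Finset.mul_sum, ← Finset.mul_sum]
  congr 1
  have h3 : insert p Bᶜ = (B.erase p)ᶜ := by
    ext i; simp only [Finset.mem_insert, Finset.mem_compl, Finset.mem_erase]; grind
  rw [h3, Finset.sum_boole, Finset.sum_boole]
  congr 1
  -- Adding `g j` completes the image of `B.erase p` to `B` exactly when that image is `B.erase r`
  -- with `r = g j`.
  refine Finset.card_bij (fun j _ => g j) ?_ (fun _ _ _ _ h => g.injective h) ?_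
  · intro j hj
    simp only [Finset.mem_filter, Finset.mem_compl] at hj ⊢
    have hj' : g j ∉ (B.erase p).map g.toEmbedding := by
      simpa [Finset.mem_map_equiv] using hj.1
    refine ⟨hj.2 ▸ Finset.mem_insert_self _ _, ?_⟩
    conv_rhs => rw [← hj.2]
    exact (Finset.erase_insert hj').symm
  · intro r hr
    simp only [Finset.mem_filter] at hr
    refine ⟨g.symm r, ?_, by simp⟩
    simp only [Finset.mem_filter, Finset.mem_compl, Equiv.apply_symm_apply]
    refine ⟨?_, ?_⟩
    · rw [← Finset.mem_map_equiv, hr.2]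
      simp
    · rw [hr.2, Finset.insert_erase hr.1]

/-- Neither `r` nor `s` lies in `B.erase r`, so `h ↦ h * swap r s` permutes the row group, keeps the
condition and flips the sign: the sum equals its negative. -/
theorem sum_rowGroup_sign_eq_zero {r s : Fin n} (hr : r ∈ B) (hs : s ∉ B)
    (hrs : swap r s ∈ rowGroup τ) (S : Finset (Fin n)) (g : Perm (Fin n))
    [DecidablePred (· ∈ rowGroup τ)] :
    ∑ h : Perm (Fin n) with h ∈ rowGroup τ, ((Perm.sign (h⁻¹ * g) : ℤ) : ℝ) *
      (if S.map (h⁻¹ * g).toEmbedding = B.erase r then 1 else 0) = 0 := by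
  have hne : r ≠ s := by rintro rfl; exact hs hr
  have hB : (B.erase r).map (swap r s).toEmbedding = B.erase r := by
    ext i
    simp only [Finset.mem_map_equiv, symm_swap, Finset.mem_erase]
    rcases eq_or_ne i r with rfl | h
    · simp [hs]
    · rcases eq_or_ne i s with rfl | h'
      · simp [hs]
      · rw [swap_apply_of_ne_of_ne h h']
  rw [← self_eq_neg, ← Finset.sum_neg_distrib]
  refine Finset.sum_equiv (Equiv.mulRight (swap r s)) ?_ ?_
  · intro h
    simp only [Finset.mem_filter, Finset.mem_univ, true_and, Equiv.coe_mulRight]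
    constructor
    · intro hh i
      rw [Perm.mul_apply, hh, hrs]
    · intro hh i
      have := hh (swap r s i)
      rw [Perm.mul_apply, swap_apply_self, hrs] at this
      exact this
  · intro h _
    have h1 : (h * swap r s)⁻¹ * g = swap r s * (h⁻¹ * g) := by
      rw [mul_inv_rev, swap_inv, mul_assoc]
    have h2 : S.map (swap r s * (h⁻¹ * g)).toEmbedding = B.erase r ↔
        S.map (h⁻¹ * g).toEmbedding = B.erase r := by
      have : S.map (swap r s * (h⁻¹ * g)).toEmbedding =
          (S.map (h⁻¹ * g).toEmbedding).map (swap r s).toEmbedding := by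
        rw [Finset.map_map]; rfl
      rw [this]
      conv_lhs => rw [← hB]
      exact Finset.map_inj
    rw [Equiv.coe_mulRight, h1, Perm.sign_mul (swap r s), Perm.sign_swap hne]
    simp only [h2]
    push_cast
    ring

/-- The Garnir relation for the exchange of a box of the second column with the first column. -/
theorem garnir_of_mem_youngIdeal (hcol : ∀ g, g ∈ colGroup τ ↔ B.map g.toEmbedding = B)
    (hrow : ∀ r ∈ B, ∃ s ∉ B, swap r s ∈ rowGroup τ) {x : ℝ[Perm (Fin n)]}
    (hx : x ∈ youngIdeal τ) {p : Fin n} (hp : p ∈ B) (g : Perm (Fin n)) :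
    ∑ j ∈ Bᶜ, x.coeff (g * swap j p) = x.coeff g := by
  classical
  obtain ⟨y, rfl⟩ := Submodule.mem_span_singleton.1 hx
  -- The relation involves only right translations, hence survives left multiplication by `y`; it
  -- suffices to check the generator.
  have hc : ∀ g, ∑ j ∈ Bᶜ, (rowSum τ * colSum τ).coeff (g * swap j p) =
      (rowSum τ * colSum τ).coeff g := by
    intro g
    rw [eq_comm, ← sub_eq_zero]
    simp only [coeff_rowSum_mul]
    rw [Finset.sum_comm, ← Finset.sum_sub_distrib]
    simp only [← mul_assoc]
    rw [Finset.sum_congr rfl fun h _ => colSum_sub_sum_swap hcol hp (h⁻¹ * g), Finset.sum_comm]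
    refine Finset.sum_eq_zero fun r hr => ?_
    obtain ⟨s, hs, hrs⟩ := hrow r hr
    exact sum_rowGroup_sign_eq_zero hr hs hrs _ g
  simp only [smul_eq_mul, coeff_mul_apply y]
  rw [Finset.sum_comm]
  refine Finset.sum_congr rfl fun k _ => ?_
  rw [← Finset.mul_sum]
  simp only [← mul_assoc]
  rw [hc]

end TwoColumns

section Star

/-! ### The Laplacian of the star -/

variable {n : ℕ} {τ : n.Partition} {B : Finset (Fin n)}

theorem starAdj_of_lt {i j l : Fin n} (hl : (l : ℕ) + 1 = n) (hij : i < j) :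
    starAdj n n i j = if j = l then 1 else 0 := by
  have h1 : (i : ℕ) < j := hij
  have h2 : i ≠ j := hij.ne
  have h3 : j = l ↔ ¬ (j : ℕ) < n - 1 := by
    rw [Fin.ext_iff]; omega
  by_cases h : (j : ℕ) < n - 1
  · have h4 : (i : ℕ) < n - 1 := by omega
    simp [starAdj, completeAdj, h2, h3, h, h4]
  · simp [starAdj, completeAdj, h2, h3, h]

theorem laplacian_star {V : Type*} [AddCommGroup V] [Module ℝ V]
    (ρ : Representation ℝ (Perm (Fin n)) V) {l : Fin n} (hl : (l : ℕ) + 1 = n) :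
    laplacian (starAdj n n) ρ = ∑ i ∈ univ.erase l, (ρ 1 - ρ (swap i l)) := by
  have h : ∀ i : Fin n, ∑ j ∈ Ioi i, starAdj n n i j • (ρ 1 - ρ (swap i j)) =
      if i ≠ l then ρ 1 - ρ (swap i l) else 0 := by
    intro i
    rw [Finset.sum_congr rfl fun j hj => by rw [starAdj_of_lt hl (Finset.mem_Ioi.1 hj)]]
    simp only [ite_smul, one_smul, zero_smul, Finset.sum_ite_eq', Finset.mem_Ioi]
    have : i < l ↔ i ≠ l := by
      rw [ne_eq, Fin.ext_iff, Fin.lt_def]; omega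
    simp only [this]
  rw [laplacian, Finset.sum_congr rfl fun i _ => h i, ← Finset.sum_filter]
  congr 1
  ext i
  simp

theorem coeff_laplacian_star {l : Fin n} (hl : (l : ℕ) + 1 = n) (x : youngIdeal τ)
    (g : Perm (Fin n)) :
    (laplacian (starAdj n n) (irrep τ) x : ℝ[Perm (Fin n)]).coeff g =
      ∑ j ∈ univ.erase (g⁻¹ l), ((x : ℝ[Perm (Fin n)]).coeff g -
        (x : ℝ[Perm (Fin n)]).coeff (g * swap j (g⁻¹ l))) := by
  have h : ∀ i, ((irrep τ 1 - irrep τ (swap i l)) x : ℝ[Perm (Fin n)]).coeff g =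
      (x : ℝ[Perm (Fin n)]).coeff g - (x : ℝ[Perm (Fin n)]).coeff (swap i l * g) := by
    intro i
    simp [irrep]
  rw [laplacian_star _ hl, LinearMap.sum_apply, Submodule.coe_sum, MonoidAlgebra.coeff_sum,
    Finsupp.finsetSum_apply, Finset.sum_congr rfl fun i _ => h i]
  refine Finset.sum_equiv g⁻¹ (by simp) fun i _ => ?_
  rw [mul_swap_eq_swap_mul]
  simp

theorem swap_mem_colGroup (hcol : ∀ g, g ∈ colGroup τ ↔ B.map g.toEmbedding = B) {j k : Fin n}
    (h : j ∈ B ↔ k ∈ B) : swap j k ∈ colGroup τ := by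
  rw [hcol]
  ext i
  rw [Finset.mem_map_equiv, symm_swap, swap_apply_def]
  split_ifs with h1 h2
  · rw [h1, h]
  · rw [h2, h]
  · rfl

theorem coeff_mul_swap (hcol : ∀ g, g ∈ colGroup τ ↔ B.map g.toEmbedding = B)
    {x : ℝ[Perm (Fin n)]} (hx : x ∈ youngIdeal τ) {j k : Fin n} (h : j ∈ B ↔ k ∈ B) (hjk : j ≠ k)
    (g : Perm (Fin n)) : x.coeff (g * swap j k) = -x.coeff g := by
  rw [coeff_mul_of_mem_youngIdeal hx (swap_mem_colGroup hcol h), Perm.sign_swap hjk]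
  simp

/-- The diagonal gives `n - 1`, the first column contributes `-1` by Garnir, and the other boxes of
`B` contribute `#B - 1` by antisymmetry. -/
theorem coeff_laplacian_star_of_mem (hcol : ∀ g, g ∈ colGroup τ ↔ B.map g.toEmbedding = B)
    (hrow : ∀ r ∈ B, ∃ s ∉ B, swap r s ∈ rowGroup τ) {l : Fin n} (hl : (l : ℕ) + 1 = n)
    (x : youngIdeal τ) {g : Perm (Fin n)} (hg : g⁻¹ l ∈ B) :
    (laplacian (starAdj n n) (irrep τ) x : ℝ[Perm (Fin n)]).coeff g =
      ((n : ℝ) - 3 + #B) * (x : ℝ[Perm (Fin n)]).coeff g := by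
  have hB : univ.erase (g⁻¹ l) = disjUnion Bᶜ (B.erase (g⁻¹ l))
      (Finset.disjoint_left.2 fun i hi hi' => by simp_all) := by
    ext i
    simp only [Finset.mem_erase, Finset.mem_univ, and_true, Finset.mem_disjUnion,
      Finset.mem_compl]
    grind
  have h2 : ∀ j ∈ B.erase (g⁻¹ l), (x : ℝ[Perm (Fin n)]).coeff (g * swap j (g⁻¹ l)) =
      -(x : ℝ[Perm (Fin n)]).coeff g := fun j hj =>
    coeff_mul_swap hcol x.2 (iff_of_true (Finset.mem_of_mem_erase hj) hg)
      (Finset.ne_of_mem_erase hj) g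
  rw [coeff_laplacian_star hl, Finset.sum_sub_distrib, Finset.sum_const,
    Finset.card_erase_of_mem (Finset.mem_univ _), hB, Finset.sum_disjUnion,
    garnir_of_mem_youngIdeal hcol hrow x.2 hg, Finset.sum_congr rfl h2, Finset.sum_const,
    Finset.card_erase_of_mem hg, Finset.card_univ, Fintype.card_fin, nsmul_eq_mul, nsmul_eq_mul,
    Nat.cast_sub (by omega), Nat.cast_sub (Finset.card_pos.2 ⟨_, hg⟩)]
  push_cast
  ring

/-- The diagonal gives `n - 1` and antisymmetry in the first column gives `n - #B - 1`; the
remaining sum moves the centre into `B`. -/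
theorem coeff_laplacian_star_of_notMem (hcol : ∀ g, g ∈ colGroup τ ↔ B.map g.toEmbedding = B)
    {l : Fin n} (hl : (l : ℕ) + 1 = n) (x : youngIdeal τ) {g : Perm (Fin n)} (hg : g⁻¹ l ∉ B) :
    (laplacian (starAdj n n) (irrep τ) x : ℝ[Perm (Fin n)]).coeff g =
      (2 * (n : ℝ) - 2 - #B) * (x : ℝ[Perm (Fin n)]).coeff g -
        ∑ p ∈ B, (x : ℝ[Perm (Fin n)]).coeff (g * swap p (g⁻¹ l)) := by
  have hg' : g⁻¹ l ∈ Bᶜ := Finset.mem_compl.2 hg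
  have hB : univ.erase (g⁻¹ l) = disjUnion B (Bᶜ.erase (g⁻¹ l))
      (Finset.disjoint_left.2 fun i hi hi' => by simp_all) := by
    ext i
    simp only [Finset.mem_erase, Finset.mem_univ, and_true, Finset.mem_disjUnion,
      Finset.mem_compl]
    grind
  have h2 : ∀ j ∈ Bᶜ.erase (g⁻¹ l), (x : ℝ[Perm (Fin n)]).coeff (g * swap j (g⁻¹ l)) =
      -(x : ℝ[Perm (Fin n)]).coeff g := fun j hj =>
    coeff_mul_swap hcol x.2
      (iff_of_false (Finset.mem_compl.1 (Finset.mem_of_mem_erase hj)) hg)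
      (Finset.ne_of_mem_erase hj) g
  have hc := Finset.card_add_card_compl B
  have hc' := Finset.card_pos.2 ⟨_, hg'⟩
  rw [Fintype.card_fin] at hc
  have hn : (n : ℝ) = #B + #Bᶜ := by exact_mod_cast hc.symm
  rw [coeff_laplacian_star hl, Finset.sum_sub_distrib, Finset.sum_const,
    Finset.card_erase_of_mem (Finset.mem_univ _), hB, Finset.sum_disjUnion,
    Finset.sum_congr rfl h2, Finset.sum_const,
    Finset.card_erase_of_mem hg', Finset.card_univ, Fintype.card_fin, nsmul_eq_mul, nsmul_eq_mul,
    Nat.cast_sub (by omega), Nat.cast_sub hc', hn]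
  push_cast
  ring

/-- For a diagram with two columns, the second of which consists of the boxes `B`, the smallest
eigenvalue of the star is the one with eigenvectors supported where the centre is in `B`. -/
theorem lambdaOne_star_of_two_columns (hcol : ∀ g, g ∈ colGroup τ ↔ B.map g.toEmbedding = B)
    (hrow : ∀ r ∈ B, ∃ s ∉ B, swap r s ∈ rowGroup τ) (hB : B.Nonempty) (hBn : 2 * #B ≤ n) :
    lambdaOne (starAdj n n) (irrep τ) = (n : ℝ) - 3 + #B := by
  obtain ⟨p, hp⟩ := hB
  obtain ⟨l, hl⟩ : ∃ l : Fin n, (l : ℕ) + 1 = n := ⟨⟨n - 1, by have := p.2; omega⟩, by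
    have := p.2; simp only; omega⟩
  have hBn' : 2 * (#B : ℝ) ≤ n := by exact_mod_cast hBn
  set T := laplacian (starAdj n n) (irrep τ) with hT
  have hswap : ∀ (g : Perm (Fin n)) (q : Fin n), (g * swap q (g⁻¹ l))⁻¹ l = q := by
    intro g q
    rw [mul_inv_rev, swap_inv, Perm.mul_apply, swap_apply_right]
  refine IsLeast.csInf_eq ⟨?_, ?_⟩
  · have hc : rowSum τ * colSum τ ∈ youngIdeal τ := Submodule.mem_span_singleton_self _
    -- Translating the Young symmetrizer moves its coefficient `1` from the identity to `swap p l`,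
    -- which has the centre in box `p` of `B`.
    let x : youngIdeal τ := irrep τ (swap p l) ⟨_, hc⟩
    have hx : (x : ℝ[Perm (Fin n)]).coeff (swap p l) = 1 := by
      have := coeff_rowSum_mul_colSum_one (τ := τ)
      simpa [x, irrep] using this
    have hpl : (swap p l)⁻¹ l ∈ B := by simpa using hp
    set β : ℝ := 2 * (n : ℝ) - 2 - #B with hβ
    -- Block triangularity gives `(T - α)(T - β) = 0`, so `y` is an `α`-eigenvector once nonzero; at
    -- `swap p l` its value is `α - β < 0`.
    set y : youngIdeal τ := T x - β • x with hy
    have hyc : ∀ g, (y : ℝ[Perm (Fin n)]).coeff g =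
        (T x : ℝ[Perm (Fin n)]).coeff g - β * (x : ℝ[Perm (Fin n)]).coeff g := by
      intro g
      simp [hy]
    have hyB : ∀ g : Perm (Fin n), g⁻¹ l ∈ B → (y : ℝ[Perm (Fin n)]).coeff g =
        ((n : ℝ) - 3 + #B - β) * (x : ℝ[Perm (Fin n)]).coeff g := by
      intro g hg
      rw [hyc, coeff_laplacian_star_of_mem hcol hrow hl x hg]
      ring
    refine Module.End.hasEigenvalue_of_hasEigenvector (x := y) ⟨?_, ?_⟩
    · rw [Module.End.mem_eigenspace_iff]
      ext g
      simp only [Submodule.coe_smul_of_tower, MonoidAlgebra.coeff_smul_apply, smul_eq_mul]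
      by_cases hg : g⁻¹ l ∈ B
      · exact coeff_laplacian_star_of_mem hcol hrow hl y hg
      · rw [coeff_laplacian_star_of_notMem hcol hl y hg, ← hβ,
          Finset.sum_congr rfl fun q hq => hyB (g * swap q (g⁻¹ l)) (by rwa [hswap]),
          ← Finset.mul_sum, hyc, coeff_laplacian_star_of_notMem hcol hl x hg]
        ring
    · intro h0
      have h1 := hyB _ hpl
      rw [hx, h0] at h1
      simp only [ZeroMemClass.coe_zero, MonoidAlgebra.coeff_zero, Finsupp.coe_zero,
        Pi.zero_apply] at h1
      linarith
  · rintro μ hμ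
    obtain ⟨x, hx⟩ := Module.End.HasEigenvalue.exists_hasEigenvector hμ
    have hxe : ∀ g, (T x : ℝ[Perm (Fin n)]).coeff g = μ * (x : ℝ[Perm (Fin n)]).coeff g := by
      intro g
      rw [hx.apply_eq_smul]
      simp
    -- A nonzero value with the centre in `B` forces `μ = α`; if there is none, the off-diagonal sum
    -- vanishes and `μ = β`.
    by_cases h : ∃ g : Perm (Fin n), g⁻¹ l ∈ B ∧ (x : ℝ[Perm (Fin n)]).coeff g ≠ 0
    · obtain ⟨g, hg, hg0⟩ := h
      have := hxe g
      rw [coeff_laplacian_star_of_mem hcol hrow hl x hg] at this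
      exact (mul_right_cancel₀ hg0 this).le
    · push Not at h
      obtain ⟨g, hg0⟩ : ∃ g, (x : ℝ[Perm (Fin n)]).coeff g ≠ 0 := by
        by_contra! h0
        exact hx.2 (by ext g; simpa using h0 g)
      have hg : g⁻¹ l ∉ B := fun hg => hg0 (h g hg)
      have := hxe g
      rw [coeff_laplacian_star_of_notMem hcol hl x hg,
        Finset.sum_eq_zero fun q hq => h _ (by rwa [hswap]), sub_zero] at this
      have := mul_right_cancel₀ hg0 this
      linarith

end Star

section Partitions

/-! ### The two partitions -/

variable {n : ℕ}

theorem rows_blocks_eq {τ : n.Partition} {L : List ℕ} (h : τ.parts = L) (hL : L.SortedGE) :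
    (rows τ).blocks = L := by
  have h1 : (rows τ).blocks = τ.parts.sort (· ≥ ·) := rfl
  rw [h1, h, Multiset.coe_sort]
  exact List.mergeSort_eq_self _ (by simpa using hL.pairwise)

theorem blocks_partitionTwo (hn : 2 ≤ n) :
    (rows (partitionTwo n hn)).blocks = 2 :: List.replicate (n - 2) 1 := by
  apply rows_blocks_eq
  · simp [partitionTwo, ← Multiset.coe_replicate]
  · rw [List.sortedGE_iff_pairwise]
    simp +contextual [List.pairwise_replicate]

theorem blocks_partitionTwoTwo (hn : 4 ≤ n) :
    (rows (partitionTwoTwo n hn)).blocks = 2 :: 2 :: List.replicate (n - 4) 1 := by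
  apply rows_blocks_eq
  · simp [partitionTwoTwo, ← Multiset.coe_replicate]
  · rw [List.sortedGE_iff_pairwise]
    simp +contextual [List.pairwise_replicate]

/-- A box is determined by the row `k` and the position `m` in it. -/
theorem index_and_invEmbedding_eq (c : Composition n) (i : Fin n) (k m : ℕ)
    (hm : m < c.blocks.getD k 0) (hi : (c.blocks.take k).sum + m = i) :
    (c.index i : ℕ) = k ∧ (c.invEmbedding i : ℕ) = m := by
  have hk : k < c.blocks.length := by
    by_contra hk
    rw [List.getD_eq_default _ _ (not_lt.1 hk)] at hm
    exact absurd hm (Nat.not_lt_zero _)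
  rw [List.getD_eq_getElem _ _ hk] at hm
  have h : c.embedding ⟨k, hk⟩ ⟨m, hm⟩ = i := by
    ext
    rw [Composition.coe_embedding]
    exact hi
  constructor
  · rw [← h, Composition.index_embedding]
  · rw [← h, Composition.invEmbedding_comp]

/-- Boxes are numbered from `0`; truncated subtraction puts both `0` and `1` in row `0`, and box `1`
alone forms the second column. -/
theorem index_and_invEmbedding_partitionTwo (hn : 2 ≤ n) (i : Fin n) :
    ((rows (partitionTwo n hn)).index i : ℕ) = i - 1 ∧
      ((rows (partitionTwo n hn)).invEmbedding i : ℕ) = if (i : ℕ) = 1 then 1 else 0 := by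
  have hb := blocks_partitionTwo hn
  obtain ⟨i, hi⟩ := i
  apply index_and_invEmbedding_eq
  · rw [hb]
    rcases i with _ | _ | i <;> simp [List.getElem?_replicate]
    rw [if_pos (by omega)]
    simp
  · rw [hb]
    rcases i with _ | _ | i <;> simp [List.take_replicate]
    omega

/-- Boxes `0, 1` and `2, 3` fill the two long rows, so the second column is `{1, 3}`. -/
theorem index_and_invEmbedding_partitionTwoTwo (hn : 4 ≤ n) (i : Fin n) :
    ((rows (partitionTwoTwo n hn)).index i : ℕ) =
        (if (i : ℕ) < 4 then (i : ℕ) / 2 else (i : ℕ) - 2) ∧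
      ((rows (partitionTwoTwo n hn)).invEmbedding i : ℕ) =
        if (i : ℕ) = 1 ∨ (i : ℕ) = 3 then 1 else 0 := by
  have hb := blocks_partitionTwoTwo hn
  obtain ⟨i, hi⟩ := i
  have h4 : ∀ i, ¬ i + 1 + 1 + 1 + 1 < 4 := by omega
  apply index_and_invEmbedding_eq
  · rw [hb]
    rcases i with _ | _ | _ | _ | i <;> simp [h4, List.getElem?_replicate]
    rw [if_pos (by omega)]
    simp
  · rw [hb]
    rcases i with _ | _ | _ | _ | i <;> simp [h4, List.take_replicate]
    omega

theorem mem_colGroup_iff_map_eq {τ : n.Partition} {B : Finset (Fin n)}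
    (h : ∀ i, ((rows τ).invEmbedding i : ℕ) = if i ∈ B then 1 else 0) (g : Perm (Fin n)) :
    g ∈ colGroup τ ↔ B.map g.toEmbedding = B := by
  have h1 : g ∈ colGroup τ ↔ ∀ i, g i ∈ B ↔ i ∈ B := by
    refine forall_congr' fun i => ?_
    rw [h, h]
    split_ifs <;> simp_all
  rw [h1, Finset.ext_iff]
  simp only [Finset.mem_map_equiv]
  constructor
  · intro h i
    simpa [iff_comm] using h (g.symm i)
  · intro h i
    simpa [iff_comm] using h (g i)

theorem swap_mem_rowGroup {τ : n.Partition} {r s : Fin n}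
    (h : ((rows τ).index r : ℕ) = (rows τ).index s) : swap r s ∈ rowGroup τ := by
  intro i
  rw [swap_apply_def]
  split_ifs with h1 h2
  · rw [h1, Fin.ext h]
  · rw [h2, Fin.ext h]
  · rfl

theorem lambdaOne_star_partitionTwo (hn : 2 ≤ n) :
    lambdaOne (starAdj n n) (irrep (partitionTwo n hn)) = (n : ℝ) - 2 := by
  have hb := index_and_invEmbedding_partitionTwo hn
  rw [lambdaOne_star_of_two_columns (B := {⟨1, by omega⟩})
    (mem_colGroup_iff_map_eq fun i => by rw [(hb i).2]; simp [Fin.ext_iff]) _ (by simp)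
    (by simpa using hn)]
  · rw [Finset.card_singleton]
    push_cast
    ring
  · intro r hr
    refine ⟨⟨0, by omega⟩, by simp, swap_mem_rowGroup ?_⟩
    rw [Finset.mem_singleton.1 hr, (hb _).1, (hb _).1]
    simp

theorem lambdaOne_star_partitionTwoTwo (hn : 4 ≤ n) :
    lambdaOne (starAdj n n) (irrep (partitionTwoTwo n hn)) = (n : ℝ) - 1 := by
  have hb := index_and_invEmbedding_partitionTwoTwo hn
  have hcard : #({⟨1, by omega⟩, ⟨3, by omega⟩} : Finset (Fin n)) = 2 :=
    Finset.card_pair (by simp)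
  rw [lambdaOne_star_of_two_columns (B := {⟨1, by omega⟩, ⟨3, by omega⟩})
    (mem_colGroup_iff_map_eq fun i => by rw [(hb i).2]; simp [Fin.ext_iff]) _ (by simp)
    (by rw [hcard]; exact hn), hcard]
  · push_cast
    ring
  · intro r hr
    rcases Finset.mem_insert.1 hr with rfl | hr
    · refine ⟨⟨0, by omega⟩, by simp, swap_mem_rowGroup ?_⟩
      rw [(hb _).1, (hb _).1]
      simp
    · rw [Finset.mem_singleton] at hr
      subst hr
      refine ⟨⟨2, by omega⟩, by simp, swap_mem_rowGroup ?_⟩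
      rw [(hb _).1, (hb _).1]
      simp

theorem starAdj_nonneg {i j : Fin n} (hij : i < j) : 0 ≤ starAdj n n i j := by
  have := j.2
  rw [starAdj_of_lt (l := ⟨n - 1, by omega⟩) (by simp only; omega) hij]
  split_ifs <;> norm_num

theorem partitionTwo_dominanceLT_partitionTwoTwo (hn : 4 ≤ n) :
    DominanceLT (partitionTwo n (le_trans (by norm_num) hn)) (partitionTwoTwo n hn) := by
  constructor
  · intro k
    rw [blocks_partitionTwo, blocks_partitionTwoTwo]
    rcases k with _ | _ | k <;> simp [List.take_replicate]
    omega
  · intro h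
    have := congrArg (fun τ => Multiset.card (Nat.Partition.parts τ)) h
    simp [partitionTwo, partitionTwoTwo] at this
    omega

end Partitions

end AldousOrder

theorem mainTheorem3 (n : ℕ) (hn : 4 ≤ n) :
    AldousOrder.lambdaOne (AldousOrder.starAdj n n)
        (AldousOrder.irrep (AldousOrder.partitionTwoTwo n hn)) = (n : ℝ) - 1 ∧
    AldousOrder.lambdaOne (AldousOrder.starAdj n n)
        (AldousOrder.irrep (AldousOrder.partitionTwo n (le_trans (by norm_num) hn))) =
      (n : ℝ) - 2 ∧
    ¬ AldousOrder.AldousLT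
        (AldousOrder.irrep (AldousOrder.partitionTwo n (le_trans (by norm_num) hn)))
        (AldousOrder.irrep (AldousOrder.partitionTwoTwo n hn)) ∧
    AldousOrder.DominanceLT
        (AldousOrder.partitionTwo n (le_trans (by norm_num) hn))
        (AldousOrder.partitionTwoTwo n hn) := by
  refine ⟨AldousOrder.lambdaOne_star_partitionTwoTwo hn,
    AldousOrder.lambdaOne_star_partitionTwo _, fun h => ?_,
    AldousOrder.partitionTwo_dominanceLT_partitionTwoTwo hn⟩
  have h1 := h.1 (AldousOrder.starAdj n n) fun i j hij => AldousOrder.starAdj_nonneg hij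
  rw [AldousOrder.lambdaOne_star_partitionTwoTwo, AldousOrder.lambdaOne_star_partitionTwo] at h1
  linarith
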